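/- Let $\omega=e^{i\pi/3}$ and divide the plane into regular hexagonal cells with centres in $\mathbb Z[\omega]$; the edges of a cell are named by the angles $0^\circ,60^\circ,\dots,300^\circ$ of their outer normals. The *subtile* is a hexagon with bumps on its edges at $60^\circ,180^\circ,-120^\circ$ and holes on its edges at $0^\circ,120^\circ,-60^\circ$; it may be rotated by multiples of $60^\circ$ but not flipped. A *tiling* places on every cell a subtile, rotated by $60^\circ k$ with $k\in\mathbb Z/6$, so that along every edge a bump meets a hole. The monotile *HexSeed* consists of 16 subtiles. Writing $(a,b)$ for the cell with centre $a+b\omega$, its subtiles, given as $(a,b){:}k$, are $(0,0){:}0$; $(1,0){:}0$, $(0,1){:}4$, $(-1,1){:}2$, $(-1,0){:}0$, $(0,-1){:}1$, $(1,-1){:}5$; $(1,1){:}2$, $(-1,2){:}3$, $(-2,1){:}4$, $(-1,-1){:}5$, $(1,-2){:}0$, $(2,-1){:}1$; $(0,2){:}4$, $(-2,0){:}0$, $(0,-2){:}1$. The *scale/substitution rule* enlarges a tiling by the factor $4$ and replaces every enlarged subtile by a copy of HexSeed in the same orientation, with the same centre; the copies have to cover every cell exactly once and all edges have to fit. A tiling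 is *built by the rule* if for every $n$ it is, up to a translation, the result of $n$ applications of the rule to some tiling. Every subtile carries a *dendrite motif*: a trunk leaving it (in standard position) at $180^\circ$, into which the three curves entering through its holes run, and two strands that start at *sources* inside the subtile and leave it at $60^\circ$ and at $-120^\circ$. Across an edge, each strand runs into the trunk of the neighbouring subtile. *Dendrites* are the connected components of the union of all these curves. **Theorem.** 1. For each of the six orientations of the subtile at the origin, the rule has exactly one fixed point, i.e. one tiling which the rule turns into itself. 2. Let $P$ be the fixed point whose subtile at the origin is in standard position. Then $P$ is built by the rule. The three strands of the subtile at the origin continue as straight infinite paths at $180^\circ$, $60^\circ$ and $-120^\circ$. The path that starts at any source of $P$ joins exactly one of these three paths, and which one it joins is decidable: for each of the three, the set of sources whose paths join it is computable. If a source's path joins the one at $60^\circ$ (at $-120^\circ$), then the first cell that it enters has its centre strictly above (below) the horizontal line through the origin. 3. In every tiling built by the rule, in particular in $P$, all dendrites are infinite, no path along a dendrite ever returns to a strand that it has left, the dendrites contain no cycle, and the tiling is nonperiodic: no translation of the plane other than the identity maps it to itself. -/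

import Mathlib

namespace HexSeed

/-- Cells of the regular hexagonal grid, in coordinates with respect to `1, ω`, where
`ω = exp (iπ/3)`: the pair `(a, b)` is the hexagon with centre `a + b ω`. -/
abbrev Cell : Type := ℤ × ℤ

/-- The centre of a cell in the plane. -/
noncomputable def centre (x : Cell) : ℂ :=
  (x.1 : ℂ) + (x.2 : ℂ) * Complex.exp (Complex.I * (Real.pi / 3))

/-- Rotation by 60° about the cell `0`. -/
def rot60 (x : Cell) : Cell := (-x.2, x.1 + x.2)

/-- Rotation by `60° * k` about the cell `0`. -/
def rot (k : ZMod 6) (x : Cell) : Cell := rot60^[k.val] x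

/-- The step from a cell to its neighbour at angle `60° * d`; also used as a name of the edge
between the two. -/
def dir (d : ZMod 6) : Cell := rot d (1, 0)

/-- The marking of the subtile. In its standard position (rotation `0`) the subtile has bumps
on its edges at 60°, 180°, -120° and holes on its edges at 0°, 120°, -60°, i.e. the cyclic
word `++--+-`. `IsBump k d`: the subtile rotated by `60° * k` has a bump at its edge at angle
`60° * d`. -/
def IsBump (k d : ZMod 6) : Prop := d - k = 1 ∨ d - k = 3 ∨ d - k = 4

/-- A placement of one subtile, in one of its six rotations (no reflections), on each cell. -/
abbrev Field : Type := Cell → ZMod 6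

/-- Along every edge a bump meets a hole. -/
def Fits (T : Field) : Prop :=
  ∀ (x : Cell) (d : ZMod 6), IsBump (T x) d ↔ ¬ IsBump (T (x + dir d)) (d + 3)

/-- The monotile in standard position: sixteen cells, each with the rotation of its subtile.
Thirteen cells are the interior of the hexagon enlarged by the factor 4; the other three lie
on the midpoints of those edges of the enlarged hexagon where the subtile has a bump. -/
def monotile : Finset (Cell × ZMod 6) :=
  {((0, 0), 0),
   ((1, 0), 0), ((0, 1), 4), ((-1, 1), 2), ((-1, 0), 0), ((0, -1), 1), ((1, -1), 5),
   ((1, 1), 2), ((-1, 2), 3), ((-2, 1), 4), ((-1, -1), 5), ((1, -2), 0), ((2, -1), 1),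
   ((0, 2), 4), ((-2, 0), 0), ((0, -2), 1)}

/-- The copy `m = (c, k)` of the monotile, rotated by `60° * k` and then centred at `c`:
its cells with the rotations of the subtiles on them. -/
def copy (m : Cell × ZMod 6) : Set (Cell × ZMod 6) :=
  {q | ∃ p ∈ monotile, q = (m.1 + rot m.2 p.1, m.2 + p.2)}

/-- The copies `C` of the monotile tile the plane, and `T` is the resulting field of
subtiles: every cell lies in exactly one copy, `T` is what the copies prescribe, and all edges
of subtiles fit. -/
def IsMonotileTiling (C : Set (Cell × ZMod 6)) (T : Field) : Prop :=
  Fits T ∧ (∀ m ∈ C, ∀ q ∈ copy m, T q.1 = q.2) ∧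
    ∀ y : Cell, ∃! m, m ∈ C ∧ y ∈ Prod.fst '' copy m

/-- The scale/substitution rule: `T` arises from the tiling `U` by enlarging it by the factor 4
and replacing every enlarged subtile by the monotile in the same orientation. -/
def Rule (U T : Field) : Prop :=
  Fits U ∧ IsMonotileTiling (Set.range fun x : Cell => ((4 : ℤ) • x, U x)) T

/-- `n` applications of the rule lead from `U` to `T`. -/
def RuleIter : ℕ → Field → Field → Prop
  | 0, U, T => U = T
  | n + 1, U, T => ∃ V, RuleIter n U V ∧ Rule V T

/-- `T` is built by the rule: for every `n` it is, up to a translation, the result of `n`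
applications of the rule to some tiling. -/
def BuiltByRule (T : Field) : Prop :=
  ∀ n : ℕ, ∃ (c : Cell) (U : Field), RuleIter n U (fun x => T (x + c))

/-- The subtiles of `T` as placed in the plane. -/
def placed (T : Field) : Set (ℂ × ZMod 6) := Set.range fun x : Cell => (centre x, T x)

/-- No translation of the plane except the identity maps the tiling to itself. -/
def Nonperiodic (T : Field) : Prop :=
  ∀ v : ℂ, (fun q : ℂ × ZMod 6 => (q.1 + v, q.2)) '' placed T = placed T → v = 0

/-- The strands of the dendrite motif on one subtile: the trunk, into which the three curves
run that enter through the holes, and two strands that start at sources inside the subtile. -/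
inductive Strand
  | trunk
  | sourceA
  | sourceB

/-- The edge of the subtile in standard position through which the strand leaves it:
180° for the trunk, 60° and -120° for the strands of the two sources. -/
def Strand.exit : Strand → ZMod 6
  | .trunk => 3
  | .sourceA => 1
  | .sourceB => 4

/-- A strand on the subtile at some cell. -/
abbrev Node : Type := Cell × Strand

/-- The strand leaves its subtile through a bump and runs into the trunk of the neighbour. -/
def flow (T : Field) (s : Node) : Node := (s.1 + dir (T s.1 + s.2.exit), .trunk)

/-- The dendrites: every strand is joined to the trunk into which it runs. -/
def dendriteGraph (T : Field) : SimpleGraph Node :=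
  SimpleGraph.fromRel fun s t => flow T s = t

/-- All dendrites are infinite. -/
def DendritesInfinite (T : Field) : Prop :=
  ∀ D : (dendriteGraph T).ConnectedComponent, D.supp.Infinite

/-- A source: a cell, and which of the two sources of the subtile on it. -/
abbrev Source : Type := Cell × Bool

/-- The strand that starts at a source. -/
def Source.node (s : Source) : Node := (s.1, if s.2 then .sourceA else .sourceB)

/-- The path that starts at the source `s` joins the path that starts with the strand `e` of
the subtile at the centre `0`. -/
def GoesTo (T : Field) (s : Source) (e : Strand) : Prop :=
  ∃ m n : ℕ, (flow T)^[m] (Source.node s) = (flow T)^[n] ((0, e) : Node)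

end HexSeed

namespace HexSeed

/-! All geometry is local: finite checks show how copies of the monotile at neighbouring points of
the enlarged grid cover, fit and carry paths. The rest is renormalization by the factor 4.

Positions: a cell `y` of the refined tiling is `4x + v` with `v` of size at most 2, so its parent
`x` is closer to the origin (`size_parent`). Hence a fixed point is determined by its rotation at
the origin, and iterating the rule from a periodic tiling converges to one.

Paths: one step in `U` becomes four straight steps in `T` (`Rule.flow_scale`), and every trunk soon
meets an enlarged centre (`Rule.reach`). So a cycle of length `L` descends to one of length `L / 4`;
for tilings built by the rule this makes every `4 ^ n` divide `L`, which is absurd. Periods descend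
in the same way. Since each strand has a single successor, the absence of directed cycles makes the
graph acyclic and its components infinite.

In the standard fixed point three straight rays reproduce themselves. Descent to the parent shows
that every path joins one of them. Rotations and destinations on a 4 × 4 window around `x` determine
those around `4x + (i, j)`, so a finite automaton reading base 4 digits computes the destination. -/

instance (k d : ZMod 6) : Decidable (IsBump k d) := by
  unfold IsBump; infer_instance

/-! ### Finite checks on copies of the monotile -/

/-- The entries of `monotile` as a list. -/
def tiles : List (Cell × ZMod 6) :=
  [((0, 0), 0),
   ((1, 0), 0), ((0, 1), 4), ((-1, 1), 2), ((-1, 0), 0), ((0, -1), 1), ((1, -1), 5),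
   ((1, 1), 2), ((-1, 2), 3), ((-2, 1), 4), ((-1, -1), 5), ((1, -2), 0), ((2, -1), 1),
   ((0, 2), 4), ((-2, 0), 0), ((0, -2), 1)]

theorem mem_tiles {p : Cell × ZMod 6} : p ∈ tiles ↔ p ∈ monotile := by
  simp only [tiles, monotile, List.mem_cons, Finset.mem_insert, Finset.mem_singleton,
    List.not_mem_nil, or_false]

/-- Representatives of all residues modulo `4` are covered by one of two adjacent fitting
monotiles. -/
theorem residue_covered : ∀ i j : Fin 4, ∃ o ∈ ([(0, 0), (1, 0), (0, 1), (1, 1)] : List Cell),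
    ∃ d : ZMod 6, ∀ k k' : ZMod 6, (IsBump k d ↔ ¬ IsBump k' (d + 3)) →
      (∃ p ∈ tiles, (((i : ℕ) : ℤ), ((j : ℕ) : ℤ)) = (4 : ℤ) • o + rot k p.1) ∨
      (∃ p ∈ tiles, (((i : ℕ) : ℤ), ((j : ℕ) : ℤ)) = (4 : ℤ) • (o + dir d) + rot k' p.1) := by
  decide +kernel

/-- Two monotiles on the enlarged grid overlap only if they are equal or share an edge that is
a bump of both. -/
theorem overlap_cases : ∀ k k' : ZMod 6, ∀ p ∈ tiles, ∀ p' ∈ tiles,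
    (4 : ℤ) ∣ (rot k p.1 - rot k' p'.1).1 → (4 : ℤ) ∣ (rot k p.1 - rot k' p'.1).2 →
      (rot k p.1 - rot k' p'.1 = 0 ∧ (k = k' → p = p')) ∨
      ∃ d : ZMod 6, rot k p.1 - rot k' p'.1 = (4 : ℤ) • dir d ∧ IsBump k d ∧
        IsBump k' (d + 3) := by
  decide +kernel

/-- Every edge of a subtile of a monotile fits, inside the monotile or across one of its sides. -/
theorem edge_cases : ∀ k : ZMod 6, ∀ p ∈ tiles, ∀ d : ZMod 6,
    (∃ p' ∈ tiles, rot k p.1 + dir d = rot k p'.1 ∧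
      (IsBump (k + p.2) d ↔ ¬ IsBump (k + p'.2) (d + 3))) ∨
    ∃ d' : ZMod 6, ∀ k' : ZMod 6, (IsBump k d' ↔ ¬ IsBump k' (d' + 3)) →
      ∃ p' ∈ tiles, rot k p.1 + dir d = (4 : ℤ) • dir d' + rot k' p'.1 ∧
        (IsBump (k + p.2) d ↔ ¬ IsBump (k' + p'.2) (d + 3)) := by
  decide +kernel

/-- A monotile shifted by a vector that is not in the enlarged grid disagrees with any monotile
on some common cell. -/
theorem shift_mismatch : ∀ i j : Fin 4, (i, j) ≠ (0, 0) →
    ∃ o ∈ ([(0, 0), (1, 0), (0, 1), (1, 1)] : List Cell),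
    ∀ k k' : ZMod 6, ∃ p ∈ tiles, ∃ p' ∈ tiles,
      (((i : ℕ) : ℤ), ((j : ℕ) : ℤ)) + rot k p.1 = (4 : ℤ) • o + rot k' p'.1 ∧
        k + p.2 ≠ k' + p'.2 := by
  decide +kernel

/-- The sup norm of the coordinates of a cell. -/
def size (y : Cell) : ℕ := max y.1.natAbs y.2.natAbs

theorem size_eq_zero {y : Cell} (h : size y = 0) : y = 0 := by
  unfold size at h
  ext <;> simp <;> omega

theorem size_rot_le : ∀ k : ZMod 6, ∀ p ∈ tiles, size (rot k p.1) ≤ 2 := by decide +kernel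

/-- The contraction estimate behind the inductions on `size`: for `size y ≥ 1` it makes the parent
`x` strictly smaller. -/
theorem size_parent {x y v : Cell} (h : y = (4 : ℤ) • x + v) (hv : size v ≤ 2) :
    4 * size x ≤ size y + 2 := by
  subst h
  simp only [size, Prod.fst_add, Prod.snd_add, Prod.smul_fst, Prod.smul_snd, smul_eq_mul] at *
  omega

/-! ### Applying the rule to a tiling -/

theorem Rule.apply_tile {U T : Field} (h : Rule U T) (x : Cell) {p : Cell × ZMod 6}
    (hp : p ∈ tiles) : T ((4 : ℤ) • x + rot (U x) p.1) = U x + p.2 :=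
  h.2.2.1 _ ⟨x, rfl⟩ (_, _) ⟨p, mem_tiles.1 hp, rfl⟩

theorem exists_residue (y : Cell) : ∃ (z : Cell) (i j : Fin 4),
    y = (4 : ℤ) • z + (((i : ℕ) : ℤ), ((j : ℕ) : ℤ)) := by
  refine ⟨(y.1 / 4, y.2 / 4), ⟨(y.1 % 4).toNat, by omega⟩, ⟨(y.2 % 4).toNat, by omega⟩, ?_⟩
  ext <;> simp <;> omega

theorem exists_tile {U : Field} (hU : Fits U) (y : Cell) :
    ∃ x : Cell, ∃ p ∈ tiles, y = (4 : ℤ) • x + rot (U x) p.1 := by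
  obtain ⟨z, i, j, hy⟩ := exists_residue y
  obtain ⟨o, -, d, h⟩ := residue_covered i j
  rcases h (U (z + o)) (U (z + o + dir d)) (hU _ _) with ⟨p, hp, h⟩ | ⟨p, hp, h⟩
  · exact ⟨_, p, hp, by rw [hy, h, smul_add, add_assoc]⟩
  · exact ⟨z + o + dir d, p, hp, by rw [hy, h]; simp only [smul_add, add_assoc]⟩

/-- Different copies could only overlap in the middle of a common side that is a bump of both, which
`Fits U` excludes. -/
theorem tile_unique {U : Field} (hU : Fits U) {x x' : Cell} {p p' : Cell × ZMod 6}
    (hp : p ∈ tiles) (hp' : p' ∈ tiles)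
    (h : (4 : ℤ) • x + rot (U x) p.1 = (4 : ℤ) • x' + rot (U x') p'.1) : x = x' ∧ p = p' := by
  have e : rot (U x) p.1 - rot (U x') p'.1 = (4 : ℤ) • (x' - x) := by
    rw [smul_sub, sub_eq_sub_iff_add_eq_add, add_comm, h, add_comm]
  rcases overlap_cases (U x) (U x') p hp p' hp'
    (by rw [e]; exact ⟨_, rfl⟩) (by rw [e]; exact ⟨_, rfl⟩) with ⟨h0, h1⟩ | ⟨d, hd, b, b'⟩
  · rw [e, smul_eq_zero_iff_right (by norm_num), sub_eq_zero] at h0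
    subst h0
    exact ⟨rfl, h1 rfl⟩
  · rw [e] at hd
    have : x' = x + dir d := by
      rw [← sub_eq_iff_eq_add']
      exact smul_right_injective _ (by norm_num : (4 : ℤ) ≠ 0) hd
    subst this
    exact absurd b' ((hU x d).1 b)

/-- The rule can be applied to every tiling. -/
theorem Fits.exists_rule {U : Field} (hU : Fits U) : ∃ T, Rule U T := by
  choose X p hp hy using exists_tile hU
  -- By uniqueness, the field defined from the chosen parents agrees with every copy.
  have key : ∀ x : Cell, ∀ q ∈ tiles,
      U (X ((4 : ℤ) • x + rot (U x) q.1)) + (p ((4 : ℤ) • x + rot (U x) q.1)).2 = U x + q.2 := by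
    intro x q hq
    obtain ⟨h1, h2⟩ := tile_unique hU hq (hp _) (hy ((4 : ℤ) • x + rot (U x) q.1))
    rw [← h1, ← h2]
  refine ⟨fun y => U (X y) + (p y).2, hU, ?_, ?_, ?_⟩
  · intro y d
    rcases edge_cases (U (X y)) (p y) (hp y) d with ⟨q, hq, h1, h2⟩ | ⟨d', h⟩
    · have e : y + dir d = (4 : ℤ) • X y + rot (U (X y)) q.1 := by
        conv_lhs => rw [hy y]
        rw [add_assoc, h1]
      simp only []
      rw [e, key _ q hq]
      exact h2
    · obtain ⟨q, hq, h1, h2⟩ := h _ (hU (X y) d')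
      have e : y + dir d = (4 : ℤ) • (X y + dir d') + rot (U (X y + dir d')) q.1 := by
        conv_lhs => rw [hy y]
        rw [add_assoc, h1, smul_add, add_assoc]
      simp only []
      rw [e, key _ q hq]
      exact h2
  · rintro _ ⟨x, rfl⟩ _ ⟨q, hq, rfl⟩
    exact key x q (mem_tiles.2 hq)
  · intro y
    refine ⟨((4 : ℤ) • X y, U (X y)), ⟨⟨X y, rfl⟩, _, ⟨p y, mem_tiles.1 (hp y), rfl⟩,
      (hy y).symm⟩, ?_⟩
    rintro _ ⟨⟨x, rfl⟩, _, ⟨q, hq, rfl⟩, h⟩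
    obtain ⟨rfl, -⟩ := tile_unique hU (mem_tiles.2 hq) (hp y) (h.trans (hy y))
    rfl

theorem Rule.fits {U T : Field} (h : Rule U T) : Fits T := h.2.1

theorem Rule.exists_tile {U T : Field} (h : Rule U T) (y : Cell) :
    ∃ x : Cell, ∃ p ∈ tiles, y = (4 : ℤ) • x + rot (U x) p.1 ∧ T y = U x + p.2 := by
  obtain ⟨x, p, hp, e⟩ := HexSeed.exists_tile h.1 y
  exact ⟨x, p, hp, e, by rw [e, h.apply_tile x hp]⟩

theorem Rule.apply_four_smul {U T : Field} (h : Rule U T) (x : Cell) :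
    T ((4 : ℤ) • x) = U x := by
  have := h.apply_tile x (p := ((0, 0), 0)) (by decide)
  have r : ∀ k : ZMod 6, rot k (0, 0) = 0 := by decide
  simpa [r] using this

/-! ### Fixed points -/

/-- The rule is contracting: values near the origin determine values farther out. -/
theorem Rule.eq_of_eq {U T U' T' : Field} (h : Rule U T) (h' : Rule U' T') {y : Cell}
    (hU : ∀ x, 4 * size x ≤ size y + 2 → U x = U' x) : T y = T' y := by
  obtain ⟨x, p, hp, e, hT⟩ := h.exists_tile y
  have hx := hU x (size_parent e (size_rot_le _ _ hp))
  rw [hT, e, hx, h'.apply_tile x hp]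

theorem fixed_unique {P Q : Field} (hP : Rule P P) (hQ : Rule Q Q) (h : P 0 = Q 0) : P = Q := by
  funext y
  induction hn : size y using Nat.strong_induction_on generalizing y with
  | _ n ih =>
    rcases Nat.eq_zero_or_pos n with rfl | hpos
    · rw [size_eq_zero hn, h]
    · exact hP.eq_of_eq hQ fun x hx => ih _ (by omega) x rfl

/-- A periodic tiling with the prescribed rotation at the origin. -/
def seed (k : ZMod 6) : Field := fun x => k + (if k.val % 2 = 0 then 2 else -2) *
  ((x.1 : ZMod 6) - (x.2 : ZMod 6))

/-- The rotation depends only on `a - b` modulo 3, which changes by ±1 along every edge; the sign in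
`seed` is adapted to the parity of `k`. -/
theorem seed_edge : ∀ k t d : ZMod 6,
    IsBump (k + (if k.val % 2 = 0 then 2 else -2) * t) d ↔
    ¬ IsBump (k + (if k.val % 2 = 0 then 2 else -2) *
      (t + (((dir d).1 : ZMod 6) - ((dir d).2 : ZMod 6)))) (d + 3) := by decide +kernel

theorem fits_seed (k : ZMod 6) : Fits (seed k) := by
  intro x d
  have := seed_edge k ((x.1 : ZMod 6) - (x.2 : ZMod 6)) d
  have e : ((x.1 : ZMod 6) - (x.2 : ZMod 6)) + (((dir d).1 : ZMod 6) - ((dir d).2 : ZMod 6)) =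
    (((x + dir d).1 : ℤ) : ZMod 6) - (((x + dir d).2 : ℤ) : ZMod 6) := by
    simp only [Prod.fst_add, Prod.snd_add, Int.cast_add]; ring
  rw [e] at this
  exact this

theorem exists_fixed (k : ZMod 6) : ∃ P, Rule P P ∧ P 0 = k := by
  choose σ hσ using fun U : {U // Fits U} => U.2.exists_rule
  let S : {U // Fits U} → {U // Fits U} := fun U => ⟨σ U, (hσ U).fits⟩
  let V : ℕ → {U // Fits U} := fun n => S^[n] ⟨seed k, fits_seed k⟩
  have hV : ∀ n, Rule (V n).1 (V (n + 1)).1 := by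
    intro n
    have : V (n + 1) = S (V n) := Function.iterate_succ_apply' _ _ _
    rw [this]
    exact hσ (V n)
  have h0 : ∀ n, (V n).1 0 = k := by
    intro n
    induction n with
    | zero => simp [V, seed]
    | succ n ih => simpa [ih] using (hV n).apply_four_smul 0
  -- The value at `y` is stable from iteration `size y` on, so the iterates have a pointwise limit.
  have hstep : ∀ n y, size y ≤ n → (V (n + 1)).1 y = (V n).1 y := by
    intro n
    induction n with
    | zero => intro y hy; rw [size_eq_zero (by omega : size y = 0), h0, h0]
    | succ n ih => intro y hy; exact (hV _).eq_of_eq (hV _) fun x hx => ih x (by omega)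
  let P : Field := fun y => (V (size y)).1 y
  have hP : ∀ n y, size y ≤ n → P y = (V n).1 y := by
    intro n y hy
    induction n, hy using Nat.le_induction with
    | base => rfl
    | succ n hn ih => rw [ih, hstep n y hn]
  have hF : Fits P := by
    intro x d
    rw [hP (max (size x) (size (x + dir d))) x (le_max_left _ _),
      hP (max (size x) (size (x + dir d))) (x + dir d) (le_max_right _ _)]
    exact (V _).2 x d
  obtain ⟨T, hT⟩ := hF.exists_rule
  have : T = P := by
    funext y
    rw [hP (size y + 1) y (by omega)]
    exact hT.eq_of_eq (hV _) fun x hx => hP _ x (by omega)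
  subst this
  exact ⟨P, hT, h0 _⟩

theorem Rule.iterate {P : Field} (h : Rule P P) : ∀ n, RuleIter n P P
  | 0 => rfl
  | n + 1 => ⟨P, h.iterate n, h⟩

theorem Rule.builtByRule {P : Field} (h : Rule P P) : BuiltByRule P :=
  fun n => ⟨0, P, by simpa using h.iterate n⟩

/-! ### Paths and their scaling -/

theorem dir_add_three (d : ZMod 6) : dir (d + 3) = -dir d := by
  revert d; decide

theorem size_add_le (x y : Cell) : size (x + y) ≤ size x + size y := by
  simp only [size, Prod.fst_add, Prod.snd_add]
  omega

theorem size_dir : ∀ d : ZMod 6, size (dir d) = 1 := by decide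

theorem isBump_iff {k d : ZMod 6} : IsBump k d ↔ ∃ e : Strand, k + e.exit = d := by
  have : ∀ k d : ZMod 6, IsBump k d ↔ (k + 3 = d ∨ k + 1 = d ∨ k + 4 = d) := by decide
  rw [this]
  constructor
  · rintro (h | h | h)
    exacts [⟨.trunk, h⟩, ⟨.sourceA, h⟩, ⟨.sourceB, h⟩]
  · rintro ⟨_ | _ | _, h⟩
    exacts [Or.inl h, Or.inr (Or.inl h), Or.inr (Or.inr h)]

theorem flow_iterate_snd (T : Field) {n : ℕ} (hn : 0 < n) (s : Node) :
    ((flow T)^[n] s).2 = .trunk := by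
  obtain ⟨m, rfl⟩ := Nat.exists_eq_add_of_lt hn
  rw [Function.iterate_succ_apply']
  rfl

theorem size_flow_iterate (T : Field) (n : ℕ) (s : Node) :
    size (((flow T)^[n] s).1 - s.1) ≤ n := by
  induction n with
  | zero => simp [size]
  | succ n ih =>
    rw [Function.iterate_succ_apply']
    have : (flow T ((flow T)^[n] s)).1 - s.1 = (((flow T)^[n] s).1 - s.1) +
        dir (T ((flow T)^[n] s).1 + ((flow T)^[n] s).2.exit) := by
      simp only [flow]; abel
    rw [this]
    refine (size_add_le _ _).trans ?_
    rw [size_dir]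
    omega

/-- A path runs straight as long as the trunks on the line point the same way. -/
theorem flow_straight {T : Field} {c : Cell} {e : Strand} {d : ZMod 6} (h0 : T c + e.exit = d)
    {n : ℕ} (h : ∀ i, 0 < i → i < n → T (c + i • dir d) + 3 = d) {j : ℕ} (hj : 0 < j)
    (hjn : j ≤ n) : (flow T)^[j] (c, e) = (c + j • dir d, .trunk) := by
  induction j, hj using Nat.le_induction with
  | base => simp [flow, h0]
  | succ j hj ih =>
    rw [Function.iterate_succ_apply', ih (by omega)]
    simp only [flow, Strand.exit]
    rw [h j hj (by omega), succ_nsmul, add_assoc]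

/-- An enlarged strand has three cells between its ends: the copy with the bump supplies two of
them, the neighbour the third (`entry_tile`). -/
theorem exit_tile : ∀ k d : ZMod 6, IsBump k d →
    (∃ p ∈ tiles, rot k p.1 = 1 • dir d ∧ k + p.2 + 3 = d) ∧
    (∃ p ∈ tiles, rot k p.1 = 2 • dir d ∧ k + p.2 + 3 = d) := by decide +kernel

theorem entry_tile : ∀ k d : ZMod 6, ¬ IsBump k (d + 3) →
    ∃ p ∈ tiles, (4 : ℤ) • dir d + rot k p.1 = 3 • dir d ∧ k + p.2 + 3 = d := by decide +kernel

/-- The enlarged strand of `x` is a straight path of four steps between cells of the enlarged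
grid. -/
theorem Rule.trunk_on_strand {U T : Field} (h : Rule U T) (x : Cell) {d : ZMod 6}
    (hd : IsBump (U x) d) {i : ℕ} (h0 : 0 < i) (h4 : i < 4) :
    T ((4 : ℤ) • x + i • dir d) + 3 = d := by
  obtain ⟨⟨p, hp, e1, e2⟩, ⟨q, hq, e3, e4⟩⟩ := exit_tile _ _ hd
  obtain ⟨r, hr, e5, e6⟩ := entry_tile _ _ ((h.1 x d).1 hd)
  interval_cases i
  · rw [← e1, h.apply_tile x hp, e2]
  · rw [← e3, h.apply_tile x hq, e4]
  · rw [← e5, ← add_assoc, ← smul_add, h.apply_tile _ hr, e6]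

theorem Rule.flow_strand {U T : Field} (h : Rule U T) (x : Cell) (e : Strand) {j : ℕ}
    (hj : 0 < j) (hj4 : j ≤ 4) :
    (flow T)^[j] ((4 : ℤ) • x, e) = ((4 : ℤ) • x + j • dir (U x + e.exit), .trunk) :=
  flow_straight (by rw [h.apply_four_smul])
    (fun _ h0 h4 => h.trunk_on_strand x (isBump_iff.2 ⟨e, rfl⟩) h0 h4) hj hj4

/-- The node of the refined tiling at the centre of an enlarged subtile. -/
def scale (s : Node) : Node := ((4 : ℤ) • s.1, s.2)

theorem scale_injective : Function.Injective scale := by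
  rintro ⟨x, e⟩ ⟨y, e'⟩ h
  simp only [scale, Prod.mk.injEq] at h
  exact Prod.ext (smul_right_injective _ (by norm_num : (4 : ℤ) ≠ 0) h.1) h.2

/-- Renormalization of paths: each step of `U` is realized by a straight run of four steps in `T`.
-/
theorem Rule.flow_scale {U T : Field} (h : Rule U T) (n : ℕ) (s : Node) :
    (flow T)^[4 * n] (scale s) = scale ((flow U)^[n] s) := by
  induction n generalizing s with
  | zero => rfl
  | succ n ih =>
    rw [Function.iterate_succ_apply, ← ih, Nat.mul_succ, Function.iterate_add_apply]
    congr 1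
    rw [scale, h.flow_strand _ _ (by norm_num) le_rfl]
    simp only [scale, flow, smul_add]
    rw [← natCast_zsmul]
    rfl

/-- A trunk is at the centre or enters it, lies on an outgoing enlarged strand, or runs into the
middle of a side. From there the enlarged strand through that side leads to a centre. -/
theorem trunk_cases : ∀ k : ZMod 6, ∀ p ∈ tiles,
    (rot k p.1 = 0 ∨ rot k p.1 + dir (k + p.2 + 3) = 0) ∨
    (∃ d, IsBump k d ∧ (rot k p.1 = 1 • dir d ∨ rot k p.1 = 2 • dir d)) ∨
    (∃ d, rot k p.1 + dir (k + p.2 + 3) = 2 • dir d) := by decide +kernel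

theorem Rule.flow_to_end {U T : Field} (h : Rule U T) (x : Cell) {d : ZMod 6}
    (hd : IsBump (U x) d) {j : ℕ} (hj : 0 < j) (hj4 : j ≤ 4) :
    (flow T)^[4 - j] ((4 : ℤ) • x + j • dir d, .trunk) = ((4 : ℤ) • (x + dir d), .trunk) := by
  obtain ⟨e, rfl⟩ := isBump_iff.1 hd
  rw [← h.flow_strand x e hj hj4, ← Function.iterate_add_apply, Nat.sub_add_cancel hj4,
    h.flow_strand x e (by norm_num) le_rfl, smul_add, ← natCast_zsmul]
  rfl

theorem Rule.flow_midpoint {U T : Field} (h : Rule U T) (x : Cell) (d : ZMod 6) :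
    ∃ z, (flow T)^[2] ((4 : ℤ) • x + 2 • dir d, .trunk) = ((4 : ℤ) • z, .trunk) := by
  by_cases hd : IsBump (U x) d
  · exact ⟨_, h.flow_to_end x hd (j := 2) (by norm_num) (by norm_num)⟩
  · have hd' : IsBump (U (x + dir d)) (d + 3) := by
      by_contra h'
      exact hd ((h.1 x d).2 h')
    have := h.flow_to_end (x + dir d) hd' (j := 2) (by norm_num) (by norm_num)
    refine ⟨_, Eq.trans ?_ this⟩
    congr 2
    rw [dir_add_three, smul_add, add_assoc]
    congr 1
    module

/-- Every trunk runs within four steps to the centre of an enlarged subtile. -/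
theorem Rule.reach {U T : Field} (h : Rule U T) (y : Cell) :
    ∃ i ≤ 4, ∃ z : Cell, (flow T)^[i] (y, .trunk) = ((4 : ℤ) • z, .trunk) := by
  obtain ⟨x, p, hp, e, hT⟩ := h.exists_tile y
  have h1 : flow T (y, .trunk) = ((4 : ℤ) • x + (rot (U x) p.1 + dir (U x + p.2 + 3)), .trunk) := by
    simp only [flow, Strand.exit, hT]
    rw [e, add_assoc]
  rcases trunk_cases (U x) p hp with (h2 | h2) | ⟨d, hd, h2 | h2⟩ | ⟨d, h2⟩
  · exact ⟨0, by norm_num, x, by simp [e, h2]⟩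
  · exact ⟨1, by norm_num, x, by simp [h1, h2]⟩
  · exact ⟨3, by norm_num, _, by
      rw [e, h2]; exact h.flow_to_end x hd (j := 1) (by norm_num) (by norm_num)⟩
  · exact ⟨2, by norm_num, _, by
      rw [e, h2]; exact h.flow_to_end x hd (j := 2) (by norm_num) (by norm_num)⟩
  · obtain ⟨z, hz⟩ := h.flow_midpoint x d
    exact ⟨3, by norm_num, z, by rw [Function.iterate_succ_apply, h1, h2, hz]⟩

/-! ### Absence of cycles -/

theorem smul_dir_mod_four : ∀ d : ZMod 6, ∀ r : Fin 4,
    (4 : ℤ) ∣ ((r : ℕ) • dir d).1 → (4 : ℤ) ∣ ((r : ℕ) • dir d).2 → r = 0 := by decide +kernel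

/-- A cycle of trunks in the refined tiling comes from one of a quarter of its length. -/
theorem Rule.cycle_descend {U T : Field} (h : Rule U T) {L : ℕ} {y : Cell}
    (hy : (flow T)^[L] (y, .trunk) = (y, .trunk)) :
    ∃ L' z, L = 4 * L' ∧ (flow U)^[L'] (z, .trunk) = (z, .trunk) := by
  obtain ⟨i, -, z, hz⟩ := h.reach y
  have hL : (flow T)^[L] (scale (z, .trunk)) = scale (z, .trunk) := by
    rw [scale, ← hz, ← Function.iterate_add_apply, add_comm, Function.iterate_add_apply, hy]
  -- Otherwise the path, having started at an enlarged centre, would end strictly between two of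
  -- them.
  have hr : L % 4 = 0 := by
    by_contra hr
    rw [← Nat.mod_add_div L 4, Function.iterate_add_apply, h.flow_scale] at hL
    obtain ⟨w, hw⟩ : ∃ w, (flow U)^[L / 4] (z, .trunk) = w := ⟨_, rfl⟩
    rw [hw, scale, h.flow_strand _ _ (by omega) (by omega), scale, Prod.mk.injEq] at hL
    have e : (L % 4) • dir (U w.1 + w.2.exit) = (4 : ℤ) • (z - w.1) := by
      rw [smul_sub, ← hL.1, add_sub_cancel_left]
    have := smul_dir_mod_four (U w.1 + w.2.exit) ⟨L % 4, by omega⟩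
      (by simp only [e]; exact ⟨_, rfl⟩) (by simp only [e]; exact ⟨_, rfl⟩)
    exact hr (congrArg Fin.val this)
  obtain ⟨L', rfl⟩ := Nat.dvd_of_mod_eq_zero hr
  rw [h.flow_scale] at hL
  exact ⟨L', z, rfl, scale_injective hL⟩

theorem RuleIter.dvd_cycle {n : ℕ} {U T : Field} (h : RuleIter n U T) {L : ℕ} {y : Cell}
    (hy : (flow T)^[L] (y, .trunk) = (y, .trunk)) : 4 ^ n ∣ L := by
  induction n generalizing T L y with
  | zero => simp
  | succ n ih =>
    obtain ⟨V, hV, hR⟩ := h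
    obtain ⟨L', z, rfl, hz⟩ := hR.cycle_descend hy
    rw [pow_succ']
    exact mul_dvd_mul_left _ (ih hV hz)

theorem flow_translate (T : Field) (c : Cell) (n : ℕ) (s : Node) :
    (flow T)^[n] (s.1 + c, s.2) =
      (((flow fun x => T (x + c))^[n] s).1 + c, ((flow fun x => T (x + c))^[n] s).2) := by
  induction n generalizing s with
  | zero => rfl
  | succ n ih =>
    rw [Function.iterate_succ_apply, Function.iterate_succ_apply, ← ih]
    simp only [flow]
    rw [add_right_comm]

theorem BuiltByRule.no_cycle {T : Field} (h : BuiltByRule T) {L : ℕ} (hL : 0 < L) (y : Cell) :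
    (flow T)^[L] (y, .trunk) ≠ (y, .trunk) := by
  intro hy
  -- Taking `n = L` suffices, since `L < 4 ^ L`.
  obtain ⟨c, U, hU⟩ := h L
  have := flow_translate T c L (y - c, .trunk)
  rw [sub_add_cancel, hy, Prod.mk.injEq] at this
  have h4 := hU.dvd_cycle (y := y - c) (L := L)
    (Prod.ext (by rw [eq_sub_iff_add_eq]; exact this.1.symm) this.2.symm)
  exact absurd (Nat.le_of_dvd hL h4) (not_le.2 (Nat.lt_pow_self (by norm_num)))

theorem BuiltByRule.flow_injective {T : Field} (h : BuiltByRule T) (s : Node) :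
    Function.Injective fun n : ℕ => (flow T)^[n] s := by
  have key : ∀ i j : ℕ, i < j → (flow T)^[i] s ≠ (flow T)^[j] s := by
    intro i j hij he
    -- One further step ensures that the repeated node is a trunk, as `no_cycle` requires.
    have e1 : (flow T)^[j - i] ((flow T)^[i + 1] s) = (flow T)^[i + 1] s := by
      rw [← Function.iterate_add_apply, show j - i + (i + 1) = j + 1 by omega,
        Function.iterate_succ_apply', Function.iterate_succ_apply', he]
    have e2 : (flow T)^[i + 1] s = (((flow T)^[i + 1] s).1, .trunk) :=
      Prod.ext rfl (flow_iterate_snd T (Nat.succ_pos i) s)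
    rw [e2] at e1
    exact h.no_cycle (by omega) _ e1
  intro i j he
  rcases lt_trichotomy i j with hij | hij | hij
  exacts [(key i j hij he).elim, hij, (key j i hij he.symm).elim]

/-! ### The dendrite graph -/

theorem adj_flow {T : Field} (s : Node) (h : flow T s ≠ s) :
    (dendriteGraph T).Adj s (flow T s) := by
  simp [dendriteGraph, SimpleGraph.fromRel_adj, h.symm]

theorem BuiltByRule.dendritesInfinite {T : Field} (h : BuiltByRule T) : DendritesInfinite T := by
  intro D
  induction D using SimpleGraph.ConnectedComponent.ind with
  | h s =>
    refine Set.infinite_of_injective_forall_mem (h.flow_injective s) fun n => ?_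
    rw [SimpleGraph.ConnectedComponent.mem_supp_iff, SimpleGraph.ConnectedComponent.eq]
    induction n with
    | zero => exact SimpleGraph.Reachable.refl _
    | succ n ih =>
      refine SimpleGraph.Reachable.trans (SimpleGraph.Adj.reachable ?_) ih
      rw [Function.iterate_succ_apply']
      refine (adj_flow _ fun he => ?_).symm
      have := @h.flow_injective _ s (n + 1) n (by simpa [Function.iterate_succ_apply'] using he)
      omega

theorem BuiltByRule.isAcyclic {T : Field} (h : BuiltByRule T) :
    (dendriteGraph T).IsAcyclic := by
  have key : ∀ s : Node, (dendriteGraph T).IsBridge s(s, flow T s) := by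
    intro s
    rw [SimpleGraph.isBridge_iff]
    intro hr
    -- Without the edge from `s` to its successor, everything still connected to `s` flows into `s`;
    -- if the successor did, there would be a directed cycle.
    have inv : ∀ t, ((dendriteGraph T).deleteEdges {s(s, flow T s)}).Reachable s t →
        ∃ n : ℕ, (flow T)^[n] t = s := by
      intro t ht
      rw [SimpleGraph.reachable_iff_reflTransGen] at ht
      induction ht with
      | refl => exact ⟨0, rfl⟩
      | @tail a b _ hab ih =>
        obtain ⟨n, hn⟩ := ih
        rw [SimpleGraph.deleteEdges_adj, dendriteGraph, SimpleGraph.fromRel_adj] at hab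
        rcases hab.1.2 with rfl | rfl
        · cases n with
          | zero =>
            obtain rfl : a = s := hn
            exact absurd rfl hab.2
          | succ n => exact ⟨n, by rwa [Function.iterate_succ_apply] at hn⟩
        · exact ⟨n + 1, by rwa [Function.iterate_succ_apply]⟩
    obtain ⟨n, hn⟩ := inv _ hr
    rw [← Function.iterate_succ_apply] at hn
    have := @h.flow_injective _ s (n + 1) 0 hn
    omega
  rw [SimpleGraph.isAcyclic_iff_forall_isBridge]
  intro e he
  induction e with
  | h a b =>
    rw [SimpleGraph.mem_edgeSet, dendriteGraph, SimpleGraph.fromRel_adj] at he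
    rcases he.2 with rfl | rfl
    · exact key a
    · rw [Sym2.eq_swap]; exact key b

/-! ### Nonperiodicity -/

theorem centre_add (x y : Cell) : centre (x + y) = centre x + centre y := by
  simp only [centre, Prod.fst_add, Prod.snd_add, Int.cast_add]; ring

theorem centre_injective : Function.Injective centre := by
  intro x y h
  have hw : Complex.exp (Complex.I * (Real.pi / 3)) = ⟨1 / 2, Real.sqrt 3 / 2⟩ := by
    have : Complex.I * (Real.pi / 3) = ((Real.pi / 3 : ℝ) : ℂ) * Complex.I := by
      push_cast; ring
    rw [this, Complex.exp_mul_I, ← Complex.ofReal_cos, ← Complex.ofReal_sin, Real.cos_pi_div_three,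
      Real.sin_pi_div_three]
    apply Complex.ext <;> simp
  simp only [centre, hw] at h
  have him := congrArg Complex.im h
  have hre := congrArg Complex.re h
  simp only [Complex.add_im, Complex.add_re, Complex.mul_im, Complex.mul_re, Complex.intCast_im,
    Complex.intCast_re, zero_mul, zero_add, add_zero, sub_zero] at him hre
  have h3 : Real.sqrt 3 / 2 ≠ 0 := by positivity
  have h2 := mul_right_cancel₀ h3 him
  rw [h2] at hre
  exact Prod.ext (by exact_mod_cast add_right_cancel hre) (by exact_mod_cast h2)

/-- A translation that maps the refined tiling to itself comes from one of the tiling that is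
refined. -/
theorem Rule.period_descend {U T : Field} (h : Rule U T) {c : Cell}
    (hc : ∀ x, T (x + c) = T x) : ∃ c', c = (4 : ℤ) • c' ∧ ∀ x, U (x + c') = U x := by
  obtain ⟨z, i, j, hz⟩ := exists_residue c
  by_cases hij : (i, j) = (0, 0)
  · obtain ⟨rfl, rfl⟩ := Prod.mk.inj hij
    have hz' : c = (4 : ℤ) • z := by rw [hz]; ext <;> simp
    refine ⟨z, hz', fun x => ?_⟩
    rw [← h.apply_four_smul, ← h.apply_four_smul, smul_add, ← hz', hc]
  · obtain ⟨o, -, hm⟩ := shift_mismatch i j hij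
    obtain ⟨p, hp, p', hp', e, hne⟩ := hm (U 0) (U (z + o))
    have h1 := h.apply_tile 0 hp
    have h2 := h.apply_tile (z + o) hp'
    rw [smul_add, add_assoc, ← e, ← add_assoc, ← hz, add_comm, hc] at h2
    rw [smul_zero, zero_add] at h1
    exact absurd (h1.symm.trans h2) hne

theorem RuleIter.dvd_period {n : ℕ} {U T : Field} (h : RuleIter n U T) {c : Cell}
    (hc : ∀ x, T (x + c) = T x) : (4 : ℤ) ^ n ∣ c.1 ∧ (4 : ℤ) ^ n ∣ c.2 := by
  induction n generalizing T c with
  | zero => simp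
  | succ n ih =>
    obtain ⟨V, hV, hR⟩ := h
    obtain ⟨c', rfl, hc'⟩ := hR.period_descend hc
    rw [pow_succ']
    exact ⟨mul_dvd_mul_left _ (ih hV hc').1, mul_dvd_mul_left _ (ih hV hc').2⟩

theorem BuiltByRule.period_eq_zero {T : Field} (h : BuiltByRule T) {c : Cell}
    (hc : ∀ x, T (x + c) = T x) : c = 0 := by
  have key : ∀ n : ℕ, (4 : ℤ) ^ n ∣ c.1 ∧ (4 : ℤ) ^ n ∣ c.2 := by
    intro n
    obtain ⟨b, U, hU⟩ := h n
    exact hU.dvd_period fun x => by rw [add_right_comm, hc]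
  have zero : ∀ a : ℤ, (∀ n : ℕ, (4 : ℤ) ^ n ∣ a) → a = 0 := by
    intro a ha
    refine Int.eq_zero_of_abs_lt_dvd (ha a.natAbs) ?_
    rw [Int.abs_eq_natAbs]
    exact_mod_cast Nat.lt_pow_self (by norm_num)
  exact Prod.ext (zero _ fun n => (key n).1) (zero _ fun n => (key n).2)

theorem BuiltByRule.nonperiodic {T : Field} (h : BuiltByRule T) : Nonperiodic T := by
  intro v hv
  have maps : ∀ x, ∃ y, centre y = centre x + v ∧ T y = T x := by
    intro x
    have : (centre x + v, T x) ∈ placed T := by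
      rw [← hv]
      exact ⟨_, ⟨x, rfl⟩, rfl⟩
    obtain ⟨y, hy⟩ := this
    exact ⟨y, congrArg Prod.fst hy, congrArg Prod.snd hy⟩
  obtain ⟨c, hc, -⟩ := maps 0
  have h0 : centre 0 = 0 := by simp [centre]
  rw [h0, zero_add] at hc
  have : c = 0 := h.period_eq_zero fun x => by
    obtain ⟨y, hy, hT⟩ := maps x
    rw [← hc, ← centre_add] at hy
    rw [← centre_injective hy, hT]
  rw [← hc, this, h0]

/-! ### The three central rays -/

/-- The offsets form a complete residue system modulo 4, so a line of subtiles pointing along itself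
is reproduced without gaps. -/
theorem line_tile : ∀ k : ZMod 6, ∀ j ∈ ([-2, -1, 0, 1] : List ℤ), ∃ p ∈ tiles,
    rot k p.1 = j • dir k ∧ k + p.2 = k := by decide +kernel

theorem Rule.line {U T : Field} (h : Rule U T) {x y : Cell} {k : ZMod 6} (hx : U x = k) {j : ℤ}
    (h1 : -2 ≤ j) (h2 : j ≤ 1) (hy : y = (4 : ℤ) • x + j • dir k) : T y = k := by
  have hj : j ∈ ([-2, -1, 0, 1] : List ℤ) := by
    simp only [List.mem_cons, List.not_mem_nil]; omega
  obtain ⟨p, hp, e1, e2⟩ := line_tile k j hj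
  have := h.apply_tile x hp
  rwa [hx, e1, ← hy, e2] at this

theorem standard_tile {P : Field} (hP : Rule P P) (h0 : P 0 = 0)
    {p : Cell × ZMod 6} (hp : p ∈ tiles) : P p.1 = p.2 := by
  have := hP.apply_tile 0 hp
  rwa [h0, smul_zero, zero_add, zero_add] at this

theorem standard_row {P : Field} (hP : Rule P P) (h0 : P 0 = 0)
    (m : ℤ) : P (m, 0) = 0 := by
  induction hn : m.natAbs using Nat.strong_induction_on generalizing m with
  | _ n ih =>
    by_cases hm : m = 0
    · subst hm; exact h0
    · refine hP.line (ih _ ?_ ((m + 2) / 4) rfl) (j := m - 4 * ((m + 2) / 4)) (by omega)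
        (by omega) ?_
      · omega
      · rw [show dir 0 = (1, 0) from rfl]
        ext <;> simp

theorem standard_up {P : Field} (hP : Rule P P) (h0 : P 0 = 0)
    (m : ℕ) (hm : 0 < m) : P (0, m) = 4 := by
  induction m using Nat.strong_induction_on with
  | _ m ih =>
    -- For `m = 1, 2` the parent would be the origin, whose rotation is not 4; these cells are read
    -- off the monotile.
    by_cases h3 : m < 3
    · interval_cases m
      exacts [standard_tile hP h0 (p := ((0, 1), 4)) (by decide),
        standard_tile hP h0 (p := ((0, 2), 4)) (by decide)]
    · refine hP.line (ih ((m + 1) / 4) (by omega) (by omega))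
        (j := 4 * (((m + 1) / 4 : ℕ) : ℤ) - m) (by omega) (by omega) ?_
      rw [show dir 4 = (0, -1) from rfl]
      ext <;> simp

theorem standard_down {P : Field} (hP : Rule P P) (h0 : P 0 = 0)
    (m : ℕ) (hm : 0 < m) : P (0, -m) = 1 := by
  induction m using Nat.strong_induction_on with
  | _ m ih =>
    by_cases h3 : m < 3
    · interval_cases m
      exacts [standard_tile hP h0 (p := ((0, -1), 1)) (by decide),
        standard_tile hP h0 (p := ((0, -2), 1)) (by decide)]
    · refine hP.line (ih ((m + 1) / 4) (by omega) (by omega))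
        (j := 4 * (((m + 1) / 4 : ℕ) : ℤ) - m) (by omega) (by omega) ?_
      rw [show dir 1 = (0, 1) from rfl]
      ext <;> simp; ring

theorem standard_ray {P : Field} (hP : Rule P P) (h0 : P 0 = 0)
    (e : Strand) {n : ℕ} (hn : 0 < n) : P (n • dir e.exit) + 3 = e.exit := by
  cases e with
  | trunk =>
    have : n • dir Strand.trunk.exit = (-(n : ℤ), 0) := by
      rw [show dir Strand.trunk.exit = (-1, 0) from rfl]; ext <;> simp
    rw [this, standard_row hP h0]; rfl
  | sourceA =>
    have : n • dir Strand.sourceA.exit = (0, (n : ℤ)) := by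
      rw [show dir Strand.sourceA.exit = (0, 1) from rfl]; ext <;> simp
    rw [this, standard_up hP h0 n hn]; rfl
  | sourceB =>
    have : n • dir Strand.sourceB.exit = (0, -(n : ℤ)) := by
      rw [show dir Strand.sourceB.exit = (0, -1) from rfl]; ext <;> simp
    rw [this, standard_down hP h0 n hn]; rfl

theorem central_flow {P : Field} (hP : Rule P P) (h0 : P 0 = 0)
    (e : Strand) {n : ℕ} (hn : 0 < n) :
    (flow P)^[n] (0, e) = (n • dir e.exit, .trunk) := by
  have := flow_straight (T := P) (c := 0) (e := e) (d := e.exit) (by rw [h0, zero_add]) (n := n)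
    (fun i hi _ => by rw [zero_add]; exact standard_ray hP h0 e hi) hn le_rfl
  rwa [zero_add] at this

theorem central_path {P : Field} (hP : Rule P P) (h0 : P 0 = 0)
    (e : Strand) (n : ℕ) : ((flow P)^[n] (0, e)).1 = n • dir e.exit := by
  rcases Nat.eq_zero_or_pos n with rfl | hn
  · simp
  · rw [central_flow hP h0 e hn]

/-! ### Which ray a path joins -/

/-- The path that starts with the strand `s` joins the path that starts with the strand `e` of
the subtile at the origin. -/
def Joins (T : Field) (s : Node) (e : Strand) : Prop :=
  ∃ m n : ℕ, (flow T)^[m] s = (flow T)^[n] ((0, e) : Node)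

theorem joins_flow_iff {T : Field} {s : Node} {e : Strand} (i : ℕ) :
    Joins T ((flow T)^[i] s) e ↔ Joins T s e := by
  constructor
  · rintro ⟨m, n, h⟩
    exact ⟨m + i, n, by rw [Function.iterate_add_apply, h]⟩
  · rintro ⟨m, n, h⟩
    exact ⟨m, i + n, by rw [← Function.iterate_add_apply, add_comm m i,
      Function.iterate_add_apply, h, Function.iterate_add_apply]⟩

theorem joins_scale {P : Field} (hP : Rule P P)
    {z : Cell} {e : Strand} (h : Joins P (z, .trunk) e) :
    Joins P ((4 : ℤ) • z, .trunk) e := by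
  obtain ⟨m, n, h⟩ := h
  refine ⟨4 * m, 4 * n, ?_⟩
  have h1 := hP.flow_scale m (z, .trunk)
  have h2 := hP.flow_scale n (0, e)
  simp only [scale, smul_zero] at h1 h2
  rw [h1, h2, h]

theorem joins_unique {P : Field} (hP : Rule P P) (h0 : P 0 = 0)
    {s : Node} {e e' : Strand} (h : Joins P s e) (h' : Joins P s e') :
    e = e' := by
  obtain ⟨m, n, h⟩ := h
  obtain ⟨m', n', h'⟩ := h'
  -- The extra step moves both rays off the origin, where their cells are disjoint.
  have key : (flow P)^[m' + n + 1] (0, e) = (flow P)^[m + n' + 1] (0, e') := by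
    rw [Function.iterate_succ_apply', Function.iterate_succ_apply', Function.iterate_add_apply,
      Function.iterate_add_apply, ← h, ← h', ← Function.iterate_add_apply,
      ← Function.iterate_add_apply, add_comm m m']
  rw [central_flow hP h0 e (by omega), central_flow hP h0 e' (by omega), Prod.mk.injEq,
    Prod.ext_iff] at key
  have hA : dir Strand.sourceA.exit = (0, 1) := rfl
  have hB : dir Strand.sourceB.exit = (0, -1) := rfl
  have hT : dir Strand.trunk.exit = (-1, 0) := rfl
  cases e <;> cases e' <;> first | rfl | (simp [hA, hB, hT] at key; try omega)

theorem row_joins {P : Field} (hP : Rule P P) (h0 : P 0 = 0)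
    (m : ℤ) : Joins P ((m, 0), .trunk) .trunk := by
  have hT : dir 3 = (-1, 0) := rfl
  rcases le_total m 0 with hm | hm
  · obtain ⟨n, rfl⟩ := Int.exists_eq_neg_ofNat hm
    rcases Nat.eq_zero_or_pos n with rfl | hn
    · exact ⟨0, 0, rfl⟩
    · refine ⟨0, n, ?_⟩
      rw [central_flow hP h0 _ hn, Strand.exit, hT]
      ext <;> simp
  · obtain ⟨n, rfl⟩ := Int.eq_ofNat_of_zero_le hm
    rcases Nat.eq_zero_or_pos n with rfl | hn
    · exact ⟨0, 0, rfl⟩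
    · refine ⟨n, 0, ?_⟩
      rw [flow_straight (d := 3) (n := n) (by rw [standard_row hP h0]; rfl) ?_ hn le_rfl, hT]
      · ext <;> simp
      · intro i _ _
        have : ((n : ℤ), (0 : ℤ)) + i • dir 3 = ((n : ℤ) - i, 0) := by
          rw [hT]; ext <;> simp; ring
        rw [this, standard_row hP h0]; rfl

theorem exists_joins_trunk {P : Field} (hP : Rule P P) (h0 : P 0 = 0)
    (y : Cell) : ∃ e, Joins P (y, .trunk) e := by
  induction hn : size y using Nat.strong_induction_on generalizing y with
  | _ n ih =>
    -- The centre reached satisfies `4 * size z ≤ n + 4`, which gives `size z < n` only from `n = 2`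
    -- on; the nine cells around the origin are treated directly.
    by_cases h2 : 2 ≤ n
    · obtain ⟨i, hi, z, hz⟩ := hP.reach y
      have hs := size_flow_iterate P i (y, .trunk)
      rw [hz] at hs
      obtain ⟨e, he⟩ := ih (size z) (by
        simp only [size, Prod.fst_sub, Prod.snd_sub, Prod.smul_fst, Prod.smul_snd,
          smul_eq_mul] at *
        omega) z rfl
      exact ⟨e, (joins_flow_iff i).1 (by rw [hz]; exact joins_scale hP he)⟩
    · have tile : ∀ p ∈ tiles, (p.1 + dir (p.2 + 3)).2 = 0 →
          Joins P (p.1, .trunk) .trunk := by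
        intro p hp hr
        refine (joins_flow_iff 1).1 ?_
        have : (flow P)^[1] (p.1, .trunk) = (((p.1 + dir (p.2 + 3)).1, 0), .trunk) := by
          simp only [Function.iterate_one, flow, Strand.exit, standard_tile hP h0 hp]
          rw [← hr]
        rw [this]
        exact row_joins hP h0 _
      obtain ⟨a, b⟩ := y
      simp only [size] at hn
      have ha : a = -1 ∨ a = 0 ∨ a = 1 := by omega
      have hb : b = -1 ∨ b = 0 ∨ b = 1 := by omega
      rcases hb with rfl | rfl | rfl
      · rcases ha with rfl | rfl | rfl
        · exact ⟨_, tile ((-1, -1), 5) (by decide) (by decide)⟩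
        · exact ⟨.sourceB, 0, 1, (central_flow hP h0 .sourceB one_pos).symm⟩
        · exact ⟨_, tile ((1, -1), 5) (by decide) (by decide)⟩
      · exact ⟨_, row_joins hP h0 a⟩
      · rcases ha with rfl | rfl | rfl
        · exact ⟨_, tile ((-1, 1), 2) (by decide) (by decide)⟩
        · exact ⟨.sourceA, 0, 1, (central_flow hP h0 .sourceA one_pos).symm⟩
        · exact ⟨_, tile ((1, 1), 2) (by decide) (by decide)⟩

theorem exists_joins {P : Field} (hP : Rule P P) (h0 : P 0 = 0)
    (s : Node) : ∃ e, Joins P s e := by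
  obtain ⟨e, he⟩ := exists_joins_trunk hP h0 (flow P s).1
  exact ⟨e, (joins_flow_iff 1).1 he⟩

/-- A path that does not join the horizontal one stays on one side of it. -/
theorem same_side {P : Field} (hP : Rule P P) (h0 : P 0 = 0)
    {s : Node} {e : Strand} (h : Joins P s e) (he : e ≠ .trunk) (i : ℕ) (σ : ℤ)
    (hσ : σ = 1 ∨ σ = -1) (hi : 0 < σ * ((flow P)^[i + 1] s).1.2) :
    0 < σ * (flow P s).1.2 := by
  have off : ∀ j : ℕ, ((flow P)^[j + 1] s).1.2 ≠ 0 := by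
    intro j hj
    have e1 : (flow P)^[j + 1] s = ((((flow P)^[j + 1] s).1.1, 0), .trunk) :=
      Prod.ext (Prod.ext rfl hj) (flow_iterate_snd P (Nat.succ_pos j) s)
    have h1 := (joins_flow_iff (j + 1)).2 h
    rw [e1] at h1
    exact he (joins_unique hP h0 h1 (row_joins hP h0 _))
  -- The height changes by at most 1 per step and is never 0 after the first, so its sign cannot
  -- change.
  have hd : ∀ d : ZMod 6, (dir d).2 ≤ 1 ∧ -1 ≤ (dir d).2 := by decide
  induction i with
  | zero => simpa using hi
  | succ i ih =>
    apply ih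
    rw [Function.iterate_succ_apply'] at hi
    have hne := off i
    have hs := hd (P ((flow P)^[i + 1] s).1 + ((flow P)^[i + 1] s).2.exit)
    have hne' := off (i + 1)
    rw [Function.iterate_succ_apply'] at hne'
    simp only [flow, Prod.snd_add] at hi hne'
    generalize (dir (P ((flow P)^[i + 1] s).1 + ((flow P)^[i + 1] s).2.exit)).2 = u at *
    generalize ((flow P)^[i + 1] s).1.2 = w at *
    rcases hσ with rfl | rfl <;> omega

theorem above_of_joins {P : Field} (hP : Rule P P) (h0 : P 0 = 0)
    {s : Node} (h : Joins P s .sourceA) : 0 < (flow P s).1.2 := by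
  obtain ⟨m, n, hmn⟩ := id h
  -- One step past the meeting point the ray has positive height even if `n = 0`.
  have := same_side hP h0 h (by simp) m 1 (Or.inl rfl) (by
    rw [Function.iterate_succ_apply', hmn, ← Function.iterate_succ_apply' (flow P), central_path hP h0,
      show dir Strand.sourceA.exit = (0, 1) from rfl]
    simp)
  simpa using this

theorem below_of_joins {P : Field} (hP : Rule P P) (h0 : P 0 = 0)
    {s : Node} (h : Joins P s .sourceB) : (flow P s).1.2 < 0 := by
  obtain ⟨m, n, hmn⟩ := id h
  have := same_side hP h0 h (by simp) m (-1) (Or.inr rfl) (by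
    rw [Function.iterate_succ_apply', hmn, ← Function.iterate_succ_apply' (flow P), central_path hP h0,
      show dir Strand.sourceB.exit = (0, -1) from rfl]
    simp)
  simpa using this

/-! ### Computability from base 4 digits -/

/-- The sign of an integer and its distance from `0` or `-1`. -/
def signMag (z : ℤ) : Bool × ℕ := ((Encodable.encode z).bodd, (Encodable.encode z).div2)

/-- The integer with the given sign and magnitude. -/
def ofSignMag (w : Bool × ℕ) : ℤ := if w.1 then Int.negSucc w.2 else Int.ofNat w.2

theorem primrec_signMag : Primrec signMag :=
  (Primrec.nat_bodd.comp .encode).pair (Primrec.nat_div2.comp .encode)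

theorem ofSignMag_signMag (z : ℤ) : ofSignMag (signMag z) = z := by
  cases z with
  | ofNat n =>
    have : Encodable.encode (Int.ofNat n) = 2 * n := rfl
    simp only [signMag, ofSignMag, this, Nat.div2_val]
    simp
  | negSucc n =>
    have : Encodable.encode (Int.negSucc n) = 2 * n + 1 := rfl
    simp [signMag, ofSignMag, this, Nat.div2_val]

/-- The last digit in base `4`, rounding down, of an integer with the given sign and last digit
of its magnitude. -/
def lastDigit (s : Bool) (r : Fin 4) : Fin 4 := if s then 3 - r else r

/-- Floor division by 4 keeps the sign and divides the magnitude, so both signs share one recursion,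
ending at 0 or -1. -/
theorem ofSignMag_eq (s : Bool) (n : ℕ) :
    ofSignMag (s, n) = 4 * ofSignMag (s, n / 4) + ((lastDigit s (Fin.ofNat 4 n) : ℕ) : ℤ) := by
  have h3 : ∀ r : Fin 4, (((3 - r : Fin 4) : ℕ) : ℤ) = 3 - ((r : ℕ) : ℤ) := by decide
  cases s
  · simp [ofSignMag, lastDigit]; omega
  · simp only [ofSignMag, lastDigit, if_true, h3, Fin.ofNat, Int.negSucc_eq]
    push_cast
    omega

theorem iterate_div_four (i n : ℕ) (h : n ≤ i) : (fun m : ℕ => m / 4)^[i] n = 0 := by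
  induction i generalizing n with
  | zero => simpa using h
  | succ i ih => rw [Function.iterate_succ_apply]; exact ih _ (by omega)

/-- A function of two integers that can be read off their base `4` digits by a finite automaton
is primitive recursive. -/
theorem primrec_of_digits {N : ℕ} (f : Cell → Fin N) (G : Fin 4 → Fin 4 → Fin N → Fin N)
    (hG : ∀ (x : Cell) (i j : Fin 4), f ((4 : ℤ) • x + (((i : ℕ) : ℤ), ((j : ℕ) : ℤ))) = G i j (f x)) :
    Primrec f := by
  let D : ℕ → ℕ → ℕ := fun i n => (fun m : ℕ => m / 4)^[i] n
  have hD : Primrec₂ D :=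
    Primrec.nat_iterate (f := fun p : ℕ × ℕ => p.1) (g := fun p => p.2) (h := fun _ m => m / 4)
      .fst .snd ((Primrec.nat_div.comp .snd (.const 4)).to₂)
  have hO : Primrec (Fin.ofNat 4) :=
    Primrec.fin_val_iff.1 (Primrec.nat_mod.comp .id (.const 4))
  let W := (Bool × ℕ) × (Bool × ℕ)
  let base : Bool × Bool → Fin N := fun q => f (ofSignMag (q.1, 0), ofSignMag (q.2, 0))
  let K : ((Bool × Fin 4) × (Bool × Fin 4)) × Fin N → Fin N := fun q =>
    G (lastDigit q.1.1.1 q.1.1.2) (lastDigit q.1.2.1 q.1.2.2) q.2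
  -- A crude bound on the number of digits; surplus leading digits are harmless because 0 and -1 are
  -- fixed by floor division by 4.
  let len : W → ℕ := fun w => w.1.2 + w.2.2
  let step : W → ℕ × Fin N → Fin N := fun w q =>
    K (((w.1.1, Fin.ofNat 4 (D (len w - 1 - q.1) w.1.2)),
      (w.2.1, Fin.ofNat 4 (D (len w - 1 - q.1) w.2.2))), q.2)
  let run : W → ℕ → Fin N := fun w n =>
    n.rec (motive := fun _ => Fin N) (base (w.1.1, w.2.1)) fun n IH => step w (n, IH)
  have hlen : Primrec len :=
    Primrec.nat_add.comp (Primrec.snd.comp .fst) (Primrec.snd.comp .snd)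
  have hidx : Primrec fun q : W × (ℕ × Fin N) => len q.1 - 1 - q.2.1 :=
    Primrec.nat_sub.comp (Primrec.nat_sub.comp (hlen.comp .fst) (.const 1))
      (Primrec.fst.comp .snd)
  have hstep : Primrec₂ step := by
    refine (Primrec.dom_finite K).comp (Primrec.pair (Primrec.pair (Primrec.pair ?_ ?_)
      (Primrec.pair ?_ ?_)) (Primrec.snd.comp .snd))
    · exact Primrec.fst.comp (Primrec.fst.comp .fst)
    · exact hO.comp (hD.comp hidx (Primrec.snd.comp (Primrec.fst.comp .fst)))
    · exact Primrec.fst.comp (Primrec.snd.comp .fst)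
    · exact hO.comp (hD.comp hidx (Primrec.snd.comp (Primrec.snd.comp .fst)))
  have hrun : Primrec fun w : W => run w (len w) :=
    Primrec.nat_rec' hlen ((Primrec.dom_finite base).comp
      (Primrec.pair (Primrec.fst.comp .fst) (Primrec.fst.comp .snd))) hstep
  -- Digits are read from the top: after `n` steps the state belongs to the coordinates without
  -- their last `len w - n` digits.
  have spec : ∀ (w : W) (n : ℕ), n ≤ len w → run w n =
      f (ofSignMag (w.1.1, D (len w - n) w.1.2), ofSignMag (w.2.1, D (len w - n) w.2.2)) := by
    intro w n
    induction n with
    | zero =>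
      intro _
      have h1 : D (len w - 0) w.1.2 = 0 := iterate_div_four _ _ (by simp only [len]; omega)
      have h2 : D (len w - 0) w.2.2 = 0 := iterate_div_four _ _ (by simp only [len]; omega)
      rw [h1, h2]; rfl
    | succ n ih =>
      intro hn
      have e : ∀ m : ℕ, D (len w - n) m = D (len w - (n + 1)) m / 4 := by
        intro m
        have : len w - n = len w - (n + 1) + 1 := by omega
        rw [this]
        exact Function.iterate_succ_apply' _ _ _
      have hr : run w (n + 1) = step w (n, run w n) := rfl
      rw [hr, ih (by omega), e, e]
      simp only [step, K]
      rw [← hG, show len w - 1 - n = len w - (n + 1) by omega]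
      congr 1
      ext
      · exact (ofSignMag_eq _ _).symm
      · exact (ofSignMag_eq _ _).symm
  refine (hrun.comp (Primrec.pair (primrec_signMag.comp .fst) (primrec_signMag.comp .snd))).of_eq
    fun x => ?_
  rw [spec _ _ le_rfl, Nat.sub_self]
  exact congrArg f (Prod.ext (ofSignMag_signMag x.1) (ofSignMag_signMag x.2))

/-- A predicate on cells with a flag is decidable if it depends only on a finite state that can
be read off the base `4` digits. -/
theorem computablePred_of_finite_state {S : Type*} [Finite S] (f : Cell → S)
    (hf : ∀ x x' : Cell, f x = f x' → ∀ i j : Fin 4,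
      f ((4 : ℤ) • x + (((i : ℕ) : ℤ), ((j : ℕ) : ℤ))) =
        f ((4 : ℤ) • x' + (((i : ℕ) : ℤ), ((j : ℕ) : ℤ))))
    (p : Cell × Bool → Prop) (hp : ∀ x x' b, f x = f x' → (p (x, b) ↔ p (x', b))) :
    ComputablePred p := by
  classical
  obtain ⟨N, ⟨E⟩⟩ := Finite.exists_equiv_fin S
  have : Nonempty (Fin N) := ⟨E (f 0)⟩
  -- The transition table need not be explicit: every function between finite types is primitive
  -- recursive.
  have hG : ∀ i j : Fin 4, ∃ g : Fin N → Fin N,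
      (fun x => E (f ((4 : ℤ) • x + (((i : ℕ) : ℤ), ((j : ℕ) : ℤ))))) = g ∘ (fun x => E (f x)) :=
    fun i j => (Function.factorsThrough_iff _).1 fun x x' h =>
      congrArg E (hf x x' (E.injective h) i j)
  choose G hG using hG
  have prim := primrec_of_digits (fun x => E (f x)) G fun x i j => congrFun (hG i j) x
  obtain ⟨H, hH⟩ : ∃ H : Fin N × Bool → Bool,
      (fun a => decide (p a)) = H ∘ fun a : Cell × Bool => (E (f a.1), a.2) := by
    refine (Function.factorsThrough_iff _).1 ?_
    rintro ⟨x, b⟩ ⟨x', b'⟩ h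
    obtain ⟨h1, rfl⟩ := Prod.mk.inj h
    exact decide_eq_decide.2 (hp x x' b (E.injective h1))
  refine ⟨inferInstance, ?_⟩
  rw [hH]
  exact ((Primrec.dom_finite H).comp
    ((prim.comp Primrec.fst).pair Primrec.snd)).to_comp

theorem exit_injective : Function.Injective Strand.exit := by
  intro e e'
  cases e <;> cases e' <;> first | exact fun _ => rfl | exact fun h => absurd h (by decide)

instance : Finite Strand := Finite.of_injective _ exit_injective

/-! ### The finite state of a window -/

/-- Both coordinates lie between `a` and `b`. -/
def InBox (a b : ℤ) (d : Cell) : Prop := a ≤ d.1 ∧ d.1 ≤ b ∧ a ≤ d.2 ∧ d.2 ≤ b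

/-- Equal rotations around `x` and `x'` lead to equal rotations around `4x` and `4x'`. -/
theorem Rule.eq_of_window {U T : Field} (h : Rule U T) {x x' : Cell}
    (hw : ∀ d, InBox (-1) 2 d → U (x + d) = U (x' + d)) {q : Cell} (hq : InBox (-5) 9 q) :
    T ((4 : ℤ) • x + q) = T ((4 : ℤ) • x' + q) := by
  obtain ⟨w, p, hp, e, hT⟩ := h.exists_tile ((4 : ℤ) • x + q)
  obtain ⟨d, rfl⟩ : ∃ d, w = x + d := ⟨w - x, by abel⟩
  have hq' : q = (4 : ℤ) • d + rot (U (x + d)) p.1 := by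
    rw [smul_add, add_assoc] at e
    exact add_left_cancel e
  have hs := size_rot_le (U (x + d)) p hp
  -- Here `4d` differs from `q` by at most 2, so it lies between -7 and 11 and `d` between -1 and 2.
  have hd := hw d (by
    have e1 := congrArg Prod.fst hq'
    have e2 := congrArg Prod.snd hq'
    simp only [InBox, size, Prod.fst_add, Prod.snd_add, Prod.smul_fst, Prod.smul_snd,
      smul_eq_mul] at *
    omega)
  rw [hT, hq', hd, ← add_assoc, ← smul_add, h.apply_tile _ hp]

/-- Four steps from the smaller box stay in the larger one, where the rotations agree, so both paths
make the same moves. -/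
theorem Rule.flow_eq_of_window {U T : Field} (h : Rule U T) {x x' : Cell}
    (hw : ∀ d, InBox (-1) 2 d → U (x + d) = U (x' + d)) {q : Cell} (hq : InBox (-1) 5 q)
    {i : ℕ} (hi : i ≤ 4) :
    ∃ r, InBox (-5) 9 r ∧ ((flow T)^[i] ((4 : ℤ) • x + q, .trunk)) = ((4 : ℤ) • x + r, .trunk) ∧
      ((flow T)^[i] ((4 : ℤ) • x' + q, .trunk)) = ((4 : ℤ) • x' + r, .trunk) := by
  have box : ∀ (j : ℕ) (r : Cell), j ≤ 4 →
      (flow T)^[j] ((4 : ℤ) • x + q, .trunk) = ((4 : ℤ) • x + r, .trunk) → InBox (-5) 9 r := by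
    intro j r hj hr
    have := size_flow_iterate T j ((4 : ℤ) • x + q, .trunk)
    rw [hr, add_sub_add_left_eq_sub] at this
    simp only [InBox, size, Prod.fst_sub, Prod.snd_sub] at *
    omega
  induction i with
  | zero => exact ⟨q, box 0 q hi rfl, rfl, rfl⟩
  | succ i ih =>
    obtain ⟨r, hr, h1, h2⟩ := ih (by omega)
    have e1 : (flow T)^[i + 1] ((4 : ℤ) • x + q, .trunk) =
        ((4 : ℤ) • x + (r + dir (T ((4 : ℤ) • x + r) + 3)), .trunk) := by
      rw [Function.iterate_succ_apply', h1, ← add_assoc]; rfl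
    refine ⟨_, box _ _ hi e1, e1, ?_⟩
    rw [Function.iterate_succ_apply', h2, ← add_assoc, h.eq_of_window hw hr]; rfl

/-- The rotations near a cell, and which central paths the nearby trunks join, determine the same
data for the cells of the enlarged subtiles. -/
theorem joins_eq_of_window {P : Field} (hP : Rule P P) (h0 : P 0 = 0)
    {x x' : Cell} (hw : ∀ d, InBox (-1) 2 d → P (x + d) = P (x' + d))
    (hj : ∀ d, InBox (-1) 2 d → Joins P (x + d, .trunk) = Joins P (x' + d, .trunk))
    {q : Cell} (hq : InBox (-1) 5 q) :
    Joins P ((4 : ℤ) • x + q, .trunk) = Joins P ((4 : ℤ) • x' + q, .trunk) := by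
  -- The converse of `joins_scale` follows from existence and uniqueness of the destination.
  have up : ∀ z, Joins P ((4 : ℤ) • z, .trunk) = Joins P (z, .trunk) := by
    intro z
    obtain ⟨e, he⟩ := exists_joins hP h0 (z, .trunk)
    funext e'
    refine propext ⟨fun h => ?_, joins_scale hP⟩
    rwa [joins_unique hP h0 h (joins_scale hP he)]
  obtain ⟨i, hi, z, hz⟩ := hP.reach ((4 : ℤ) • x + q)
  obtain ⟨r, hr, h1, h2⟩ := hP.flow_eq_of_window hw hq hi
  obtain ⟨d, rfl⟩ : ∃ d, z = x + d := ⟨z - x, by abel⟩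
  have hrd : r = (4 : ℤ) • d := by
    rw [h1, smul_add, Prod.mk.injEq] at hz
    exact add_left_cancel hz.1
  rw [hrd, ← smul_add] at h1 h2
  -- The window closes up: a multiple `4d` between -5 and 9 has `d` between -1 and 2.
  have hd : InBox (-1) 2 d := by
    rw [hrd] at hr
    simp only [InBox, Prod.smul_fst, Prod.smul_snd, smul_eq_mul] at *
    omega
  funext e
  rw [← joins_flow_iff (s := ((4 : ℤ) • x + q, .trunk)) i,
    ← joins_flow_iff (s := ((4 : ℤ) • x' + q, .trunk)) i, h1, h2, up, up, hj d hd]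

theorem computable_goesTo {P : Field} (hP : Rule P P) (h0 : P 0 = 0)
    (e : Strand) : ComputablePred fun s : Source => GoesTo P s e := by
  choose dest hdest using fun y => exists_joins hP h0 (y, .trunk)
  have hiff : ∀ y, Joins P (y, .trunk) = fun e' => dest y = e' := fun y =>
    funext fun e' => propext ⟨fun h => joins_unique hP h0 (hdest y) h, fun h => h ▸ hdest y⟩
  let off : Fin 4 × Fin 4 → Cell := fun t => (((t.1 : ℕ) : ℤ) - 1, ((t.2 : ℕ) : ℤ) - 1)
  let f : Cell → Fin 4 × Fin 4 → ZMod 6 × Strand := fun x t => (P (x + off t), dest (x + off t))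
  have window : ∀ x x', f x = f x' → ∀ d, InBox (-1) 2 d →
      P (x + d) = P (x' + d) ∧ Joins P (x + d, .trunk) = Joins P (x' + d, .trunk) := by
    intro x x' h d hd
    obtain ⟨t, rfl⟩ : ∃ t, d = off t := by
      simp only [InBox] at hd
      refine ⟨(⟨(d.1 + 1).toNat, by omega⟩, ⟨(d.2 + 1).toNat, by omega⟩), ?_⟩
      ext <;> simp only [off] <;> omega
    have ht := Prod.mk.inj (congrFun h t)
    exact ⟨ht.1, by rw [hiff, hiff, ht.2]⟩
  have : Finite (ZMod 6) := inferInstanceAs (Finite (Fin 6))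
  refine computablePred_of_finite_state f ?_ _ ?_
  · intro x x' h i j
    funext t
    have hq : InBox (-1) 5 ((((i : ℕ) : ℤ), ((j : ℕ) : ℤ)) + off t) := by
      simp only [InBox, off, Prod.fst_add, Prod.snd_add]
      omega
    have hq' : InBox (-5) 9 ((((i : ℕ) : ℤ), ((j : ℕ) : ℤ)) + off t) := by
      simp only [InBox] at *
      omega
    have hw := fun d hd => (window x x' h d hd).1
    simp only [f, add_assoc]
    refine Prod.ext (hP.eq_of_window hw hq') ?_
    have := joins_eq_of_window hP h0 hw (fun d hd => (window x x' h d hd).2) hq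
    rw [hiff, hiff] at this
    exact (congrFun this _).mpr rfl
  · intro x x' b h
    -- The state records destinations of trunks only; the first step from a source enters a trunk
    -- inside the window.
    have key : ∀ y, GoesTo P (y, b) e ↔ Joins P (flow P (Source.node (y, b))) e := fun y =>
      (joins_flow_iff 1).symm
    have hx : P x = P x' := by
      simpa using (window x x' h 0 (by simp [InBox])).1
    have hbox : ∀ d : ZMod 6, -1 ≤ (dir d).1 ∧ (dir d).1 ≤ 2 ∧ -1 ≤ (dir d).2 ∧ (dir d).2 ≤ 2 := by
      decide
    rw [key, key]
    simp only [flow, Source.node]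
    rw [hx, (window x x' h _ (hbox _)).2]

end HexSeed

theorem mainTheorem1 :
    -- for each rotation of the central subtile the rule has exactly one fixed point
    (∀ k : ZMod 6, ∃! P : HexSeed.Field, HexSeed.Rule P P ∧ P 0 = k) ∧
    -- the fixed point with central subtile in standard position
    (∀ P : HexSeed.Field, HexSeed.Rule P P → P 0 = 0 →
      HexSeed.BuiltByRule P ∧
      -- the three strands of the central subtile run straight to infinity, at 180°, 60°, -120°
      (∀ (e : HexSeed.Strand) (n : ℕ),
        ((HexSeed.flow P)^[n] (0, e)).1 = n • HexSeed.dir e.exit) ∧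
      -- every source goes to exactly one of these three dendrites
      (∀ s : HexSeed.Source, ∃! e : HexSeed.Strand, HexSeed.GoesTo P s e) ∧
      -- to which one is decidable
      (∀ e : HexSeed.Strand, ComputablePred fun s : HexSeed.Source => HexSeed.GoesTo P s e) ∧
      -- only sources above (below) the horizontal dendrite go to the one at 60° (-120°)
      (∀ s : HexSeed.Source, HexSeed.GoesTo P s .sourceA →
        0 < (HexSeed.flow P (HexSeed.Source.node s)).1.2) ∧
      (∀ s : HexSeed.Source, HexSeed.GoesTo P s .sourceB →
        (HexSeed.flow P (HexSeed.Source.node s)).1.2 < 0)) ∧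
    -- every tiling built by the rule has only infinite dendrites, none of them with a cycle,
    -- and is nonperiodic
    (∀ T : HexSeed.Field, HexSeed.BuiltByRule T →
      HexSeed.DendritesInfinite T ∧
      (∀ s : HexSeed.Node, Function.Injective fun n : ℕ => (HexSeed.flow T)^[n] s) ∧
      (HexSeed.dendriteGraph T).IsAcyclic ∧
      HexSeed.Nonperiodic T) := by
  refine ⟨fun k => ?_, fun P hP h0 => ⟨hP.builtByRule, HexSeed.central_path hP h0, fun s => ?_,
    HexSeed.computable_goesTo hP h0, fun s => HexSeed.above_of_joins hP h0,
    fun s => HexSeed.below_of_joins hP h0⟩,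
    fun T hT => ⟨hT.dendritesInfinite, hT.flow_injective, hT.isAcyclic, hT.nonperiodic⟩⟩
  · obtain ⟨P, hP, h0⟩ := HexSeed.exists_fixed k
    exact ⟨P, ⟨hP, h0⟩, fun Q hQ => HexSeed.fixed_unique hQ.1 hP (hQ.2.trans h0.symm)⟩
  · obtain ⟨e, he⟩ := HexSeed.exists_joins hP h0 (HexSeed.Source.node s)
    exact ⟨e, he, fun e' he' => HexSeed.joins_unique hP h0 he' he⟩
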